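/- Let $1\le n\le m$ be integers and let $L\subset\mathbb{R}^m$ be an $n$-dimensional lattice, that is, the set of all integer combinations of $n$ vectors of $\mathbb{R}^m$ that are linearly independent over $\mathbb{R}$. A basis of $L$ is a matrix $B=[b_1|\ldots|b_n]^t\in\mathbb{R}^{n\times m}$ whose rows $b_1,\dots,b_n$ are linearly independent over $\mathbb{R}$ and satisfy $L=\{\sum_{i=1}^n a_ib_i : a_i\in\mathbb{Z}\}$. Its dual basis is $B^*=[b_1^*|\ldots|b_n^*]^t=(B^+)^t$, where $B^+$ is the Moore–Penrose inverse of $B$, and its Seysen measure is $S(B)=\sum_{i=1}^n\|b_i\|^2\,\|b_i^*\|^2$, with $\|\cdot\|$ the Euclidean norm. Then $L$ has a basis $B$ such that $$S(B)\le\exp\left(\left(\frac{2}{\ln 2}+1\right)(\ln n)^2+4\ln n\right).$$ -/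

import Mathlib

open Matrix

namespace SeysenMeasure

/-- The `i`-th row of a real matrix, as a vector of Euclidean space. -/
noncomputable def rowVec {n m : ℕ} (B : Matrix (Fin n) (Fin m) ℝ) (i : Fin n) :
    EuclideanSpace ℝ (Fin m) :=
  WithLp.toLp 2 (B i)

/-- `B` is a basis of the lattice `L ⊆ ℝᵐ`: its rows are linearly independent over `ℝ`, and `L`
is the set of all integer combinations of them. -/
def IsLatticeBasis {n m : ℕ} (B : Matrix (Fin n) (Fin m) ℝ)
    (L : Submodule ℤ (EuclideanSpace ℝ (Fin m))) : Prop :=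
  LinearIndependent ℝ (rowVec B) ∧ L = Submodule.span ℤ (Set.range (rowVec B))

/-- `L ⊆ ℝᵐ` is an `n`-dimensional lattice: it is generated over `ℤ` by `n` vectors that are
linearly independent over `ℝ`. -/
def IsLattice (n : ℕ) {m : ℕ} (L : Submodule ℤ (EuclideanSpace ℝ (Fin m))) : Prop :=
  ∃ B : Matrix (Fin n) (Fin m) ℝ, IsLatticeBasis B L

/-- The four Penrose equations: `P` is the Moore-Penrose inverse of the real matrix `B`. -/
def IsMoorePenroseInverse {n m : ℕ} (B : Matrix (Fin n) (Fin m) ℝ)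
    (P : Matrix (Fin m) (Fin n) ℝ) : Prop :=
  B * P * B = B ∧ P * B * P = P ∧ (B * P)ᵀ = B * P ∧ (P * B)ᵀ = P * B

/-- The dual basis `B* = (B⁺)ᵗ`, where `B⁺ = Bᵗ (B Bᵗ)⁻¹` is the Moore-Penrose inverse of a matrix
`B` with linearly independent rows (see `dualBasis_isMoorePenroseInverse` and
`IsMoorePenroseInverse.unique`). -/
noncomputable def dualBasis {n m : ℕ} (B : Matrix (Fin n) (Fin m) ℝ) :
    Matrix (Fin n) (Fin m) ℝ :=
  (Bᵀ * (B * Bᵀ)⁻¹)ᵀ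

/-- The Seysen measure `S(B) = ∑ᵢ ‖bᵢ‖² ‖bᵢ*‖²`, with Euclidean norms. -/
noncomputable def seysenMeasure {n m : ℕ} (B : Matrix (Fin n) (Fin m) ℝ) : ℝ :=
  ∑ i, ‖rowVec B i‖ ^ 2 * ‖rowVec (dualBasis B) i‖ ^ 2

theorem IsMoorePenroseInverse.unique {n m : ℕ} {B : Matrix (Fin n) (Fin m) ℝ}
    {P Q : Matrix (Fin m) (Fin n) ℝ} (hP : IsMoorePenroseInverse B P)
    (hQ : IsMoorePenroseInverse B Q) : P = Q := by
  obtain ⟨p1, p2, p3, p4⟩ := hP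
  obtain ⟨q1, q2, q3, q4⟩ := hQ
  have h1 : B * P = B * Q := by
    calc B * P = (B * P)ᵀ := p3.symm
      _ = ((B * Q) * (B * P))ᵀ := by rw [← Matrix.mul_assoc, q1]
      _ = (B * P) * (B * Q) := by rw [Matrix.transpose_mul, p3, q3]
      _ = B * Q := by rw [← Matrix.mul_assoc, p1]
  have h2 : P * B = Q * B := by
    calc P * B = (P * B)ᵀ := p4.symm
      _ = ((P * B) * (Q * B))ᵀ := by rw [Matrix.mul_assoc, ← Matrix.mul_assoc B, q1]
      _ = (Q * B) * (P * B) := by rw [Matrix.transpose_mul, p4, q4]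
      _ = Q * B := by rw [Matrix.mul_assoc, ← Matrix.mul_assoc B, p1]
  calc P = P * B * P := p2.symm
    _ = Q * (B * P) := by rw [h2, Matrix.mul_assoc]
    _ = Q := by rw [h1, ← Matrix.mul_assoc, q2]

theorem isUnit_det_gram {n m : ℕ} {B : Matrix (Fin n) (Fin m) ℝ}
    (hB : LinearIndependent ℝ (rowVec B)) : IsUnit (B * Bᵀ).det := by
  have h : LinearIndependent ℝ B.row :=
    hB.map' (WithLp.linearEquiv 2 ℝ (Fin m → ℝ)).toLinearMap
      (LinearEquiv.ker (WithLp.linearEquiv 2 ℝ (Fin m → ℝ)))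
  have hr := h.rank_matrix
  rw [← Matrix.rank_self_mul_transpose] at hr
  have h2 : LinearIndependent ℝ (B * Bᵀ).row := by
    rw [linearIndependent_iff_card_eq_finrank_span, Set.finrank,
      ← Matrix.rank_eq_finrank_span_row]
    exact hr.symm
  exact (Matrix.isUnit_iff_isUnit_det _).1 (Matrix.linearIndependent_rows_iff_isUnit.1 h2)

theorem mul_transpose_dualBasis {n m : ℕ} {B : Matrix (Fin n) (Fin m) ℝ}
    (hB : LinearIndependent ℝ (rowVec B)) : B * (dualBasis B)ᵀ = 1 := by
  rw [dualBasis, Matrix.transpose_transpose, ← Matrix.mul_assoc]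
  exact Matrix.mul_nonsing_inv _ (isUnit_det_gram hB)

/-- The transpose of `dualBasis B` is the Moore-Penrose inverse of `B`, for `B` with linearly
independent rows. -/
theorem dualBasis_isMoorePenroseInverse {n m : ℕ} {B : Matrix (Fin n) (Fin m) ℝ}
    (hB : LinearIndependent ℝ (rowVec B)) : IsMoorePenroseInverse B (dualBasis B)ᵀ := by
  have h := mul_transpose_dualBasis hB
  refine ⟨?_, ?_, ?_, ?_⟩
  · rw [h, Matrix.one_mul]
  · rw [Matrix.mul_assoc, h, Matrix.mul_one]
  · rw [h, Matrix.transpose_one]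
  · rw [dualBasis, Matrix.transpose_transpose, Matrix.transpose_mul, Matrix.transpose_mul,
      Matrix.transpose_transpose, Matrix.transpose_nonsing_inv, Matrix.transpose_mul,
      Matrix.transpose_transpose, Matrix.mul_assoc]

end SeysenMeasure

/-!
For a basis `B` with Gram matrix `G = B * Bᵀ`, the Gram matrix of the dual basis is `G⁻¹`, so
`S(B) = ∑ i, G i i * G⁻¹ i i` (`seysenMeasure_eq`), and a change of lattice basis replaces `G` by
`V * G * Vᵀ` with `V` unimodular. It remains to make this sum small over the integral equivalence
class of a positive definite form (`exists_unimodular_seysen_le`). Two reductions are combined.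

* Hermite-Korkine-Zolotareff reduction (`exists_hkz`) brings `G` to the form
  `M * diagonal D * Mᵀ`, where `M` is lower unitriangular and every `D j` is the minimum of a
  projected lattice. Minkowski's theorem for a cube gives Hermite's inequality
  `D j ≤ ℓ * (D j ⋯ D (j + ℓ - 1)) ^ (1 / ℓ)` for all blocks, and these inequalities together bound
  `D j / D k` by `n * exp (∑ i ≤ n, log i / (i - 1))` for `j ≤ k` (`profile_ratio_le`), the sum
  being taken over `i ≥ 2` and being at most `(log n) ^ 2 + log 2`.
* Seysen's reduction of triangular matrices (`exists_unimodular_mul_bounded`) multiplies `M` by a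
  unimodular integer matrix so that the product `C` and its inverse have entries of absolute value
  at most `2 ^ ((r - 1) * (r - 2) / 2)`, where `r = ⌈log₂ n⌉`.

Expanding the diagonal entries of `C * diagonal D * Cᵀ` and of its inverse, `S(B)` becomes a sum
over triples `j ≤ i ≤ k` of `C i j ^ 2 * C⁻¹ k i ^ 2 * D j / D k`. It is at most `n ^ 3` times the
largest possible term. The surplus factor `2` in the bound on `D j / D k` is absorbed by the
difference between `(r - 1) * (r - 2)` and `(log₂ n) ^ 2` (`entryBound_exponent_le`).
-/

namespace SeysenMeasure

/-! ### Integer matrices and congruence of forms -/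

theorem map_intCast_mul {p q s : ℕ} (X : Matrix (Fin p) (Fin q) ℤ) (Y : Matrix (Fin q) (Fin s) ℤ) :
    (X * Y).map (Int.cast : ℤ → ℝ) = X.map (Int.cast : ℤ → ℝ) * Y.map (Int.cast : ℤ → ℝ) :=
  Matrix.map_mul (f := Int.castRingHom ℝ)

theorem map_intCast_mul_eq_one {p : ℕ} {X Y : Matrix (Fin p) (Fin p) ℤ} (h : X * Y = 1) :
    X.map (Int.cast : ℤ → ℝ) * Y.map (Int.cast : ℤ → ℝ) = 1 := by
  rw [← map_intCast_mul, h]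
  simp

theorem dotProduct_conj_mulVec {n : ℕ} (A G : Matrix (Fin n) (Fin n) ℝ) (x : Fin n → ℝ) :
    x ⬝ᵥ (A * G * Aᵀ) *ᵥ x = (Aᵀ *ᵥ x) ⬝ᵥ G *ᵥ (Aᵀ *ᵥ x) := by
  rw [← Matrix.mulVec_mulVec, ← Matrix.mulVec_mulVec, Matrix.dotProduct_mulVec x A,
    ← Matrix.mulVec_transpose]

theorem posDef_conj {n : ℕ} {A A' G : Matrix (Fin n) (Fin n) ℝ} (hG : G.PosDef)
    (hA : A * A' = 1) : (A * G * Aᵀ).PosDef := by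
  have h := hG.mul_mul_conjTranspose_same (B := A) (Matrix.vecMul_injective_of_isUnit
    (⟨⟨A, A', hA, mul_eq_one_comm.1 hA⟩, rfl⟩))
  simpa using h

/-! ### Seysen's reduction of triangular matrices -/

/-- `A` is lower triangular: all entries above the diagonal vanish. The diagonal is unrestricted. -/
def IsLower {n : ℕ} (A : Matrix (Fin n) (Fin n) ℝ) : Prop :=
  ∀ i j, i < j → A i j = 0

theorem abs_mul_apply_le {k l p : ℕ} (X : Matrix (Fin k) (Fin l) ℝ) (Y : Matrix (Fin l) (Fin p) ℝ)
    {a b : ℝ} (hX : ∀ i j, |X i j| ≤ a) (hY : ∀ i j, |Y i j| ≤ b) (ha : 0 ≤ a)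
    (i : Fin k) (j : Fin p) : |(X * Y) i j| ≤ l * (a * b) := by
  rw [Matrix.mul_apply]
  refine (Finset.abs_sum_le_sum_abs _ _).trans ?_
  refine (Finset.sum_le_card_nsmul _ _ (a * b) fun s _ => ?_).trans ?_
  · rw [abs_mul]
    exact mul_le_mul (hX _ _) (hY _ _) (abs_nonneg _) ha
  · simp

theorem isLower_submatrix_fromBlocks {k l : ℕ} {X : Matrix (Fin k) (Fin k) ℝ}
    {Y : Matrix (Fin l) (Fin l) ℝ} (Z : Matrix (Fin l) (Fin k) ℝ) (hX : IsLower X)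
    (hY : IsLower Y) :
    IsLower ((fromBlocks X 0 Z Y).submatrix finSumFinEquiv.symm finSumFinEquiv.symm) := by
  intro i j
  refine Fin.addCases (fun i => ?_) (fun i => ?_) i <;>
    refine Fin.addCases (fun j => ?_) (fun j => ?_) j <;> intro h
  · simpa using hX i j h
  · simp
  · simp only [Fin.lt_def, Fin.val_natAdd, Fin.val_castAdd] at h
    omega
  · simpa using hY i j (by simpa using h)

/-- The bound obeyed by the entries in dimension at most `2 ^ r`: it satisfies the recursion
`f (r + 1) = 2 ^ (r - 1) * f r` for `r ≥ 1` produced by halving the matrix, with `f 0 = f 1 = 1`. -/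
noncomputable def entryBound (r : ℕ) : ℝ :=
  2 ^ ((r - 1).choose 2)

theorem one_le_entryBound (r : ℕ) : 1 ≤ entryBound r :=
  one_le_pow₀ one_le_two

theorem entryBound_le_succ (r : ℕ) : entryBound r ≤ entryBound (r + 1) :=
  pow_le_pow_right₀ one_le_two (Nat.choose_le_choose 2 (by omega))

theorem half_two_pow_mul_entryBound_le (r : ℕ) :
    2 ^ r * (1 / 2 * entryBound r) ≤ entryBound (r + 1) := by
  unfold entryBound
  rcases r with _ | r
  · norm_num
  · have h : (r + 1).choose 2 = r + r.choose 2 := by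
      rw [Nat.choose_succ_succ' r 1, Nat.choose_one_right]
    simp only [Nat.add_sub_cancel, h, pow_add]
    exact le_of_eq (by ring)

/-- Seysen's reduction of triangular matrices: a lower unitriangular real matrix `A` can be
multiplied from the left by a unimodular integer matrix so that the product and its inverse
both have small entries. Writing `A` in blocks of half the size, the diagonal blocks are reduced
recursively; the lower left block of the product can then be made equal to `R * C₁`, where `C₁`
is the reduced upper block and `R` has entries in `[-1/2, 1/2]`, and the lower left block of the
inverse is `-C₂⁻¹ * R`. -/
theorem exists_unimodular_mul_bounded (r : ℕ) : ∀ (n : ℕ), n ≤ 2 ^ r →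
    ∀ A : Matrix (Fin n) (Fin n) ℝ, IsLower A → (∀ i, A i i = 1) →
    ∃ (T T' : Matrix (Fin n) (Fin n) ℤ) (C C' : Matrix (Fin n) (Fin n) ℝ),
      T * T' = 1 ∧ C = T.map (Int.cast : ℤ → ℝ) * A ∧ C * C' = 1 ∧ IsLower C ∧ IsLower C' ∧
      (∀ i j, |C i j| ≤ entryBound r) ∧ ∀ i j, |C' i j| ≤ entryBound r := by
  induction r with
  | zero =>
    intro n hn A hA hA1
    have : Subsingleton (Fin n) := Fin.subsingleton_iff_le_one.2 (by simpa using hn)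
    have hA' : A = 1 := by
      ext i j
      obtain rfl := Subsingleton.elim i j
      simp [hA1]
    have hl : IsLower (1 : Matrix (Fin n) (Fin n) ℝ) := fun i j h => Matrix.one_apply_ne h.ne
    have hb : ∀ i j, |(1 : Matrix (Fin n) (Fin n) ℝ) i j| ≤ entryBound 0 := by
      intro i j
      obtain rfl := Subsingleton.elim i j
      simpa using one_le_entryBound 0
    exact ⟨1, 1, 1, 1, by simp, by simp [hA'], by simp, hl, hl, hb, hb⟩
  | succ r ih =>
    intro n hn A hA hA1
    obtain ⟨k, l, hk, hl, rfl⟩ : ∃ k l, k ≤ 2 ^ r ∧ l ≤ 2 ^ r ∧ n = k + l :=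
      ⟨min n (2 ^ r), n - min n (2 ^ r), by omega, by rw [pow_succ] at hn; omega, by omega⟩
    set e := (finSumFinEquiv : Fin k ⊕ Fin l ≃ Fin (k + l)) with he
    set A₁ := (A.submatrix e e).toBlocks₁₁ with hA₁
    set A₂ := (A.submatrix e e).toBlocks₂₂ with hA₂
    set E := (A.submatrix e e).toBlocks₂₁ with hE
    have hblk : A.submatrix e e = fromBlocks A₁ 0 E A₂ := by
      rw [← fromBlocks_toBlocks (A.submatrix e e)]
      congr 1
      ext i j
      refine hA _ _ ?_
      simp only [he, finSumFinEquiv_apply_left, finSumFinEquiv_apply_right, Fin.lt_def,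
        Fin.val_castAdd, Fin.val_natAdd]
      omega
    obtain ⟨T₁, T₁', C₁, C₁', hT₁, hC₁, hCC₁, hlow₁, hlow₁', hb₁, hb₁'⟩ := ih k hk A₁
      (fun i j h => hA _ _ (show Fin.castAdd l i < Fin.castAdd l j from h)) (fun i => hA1 _)
    obtain ⟨T₂, T₂', C₂, C₂', hT₂, hC₂, hCC₂, hlow₂, hlow₂', hb₂, hb₂'⟩ := ih l hl A₂
      (fun i j h => hA _ _ (show Fin.natAdd k i < Fin.natAdd k j from Nat.add_lt_add_left h k))
      (fun i => hA1 _)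
    -- Adding `-Z` times the upper block row to the lower one turns `W * C₁` into `R * C₁`.
    set W := T₂.map (Int.cast : ℤ → ℝ) * E * C₁' with hW
    set Z : Matrix (Fin l) (Fin k) ℤ := W.map round with hZ
    set R := W - Z.map (Int.cast : ℤ → ℝ) with hR
    have hRb : ∀ i j, |R i j| ≤ 1 / 2 := fun i j => abs_sub_round (W i j)
    have hCC₁' : C₁' * C₁ = 1 := mul_eq_one_comm.1 hCC₁
    have hRC : T₂.map (Int.cast : ℤ → ℝ) * E - Z.map (Int.cast : ℤ → ℝ) * C₁ = R * C₁ := by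
      rw [hR, Matrix.sub_mul, hW, Matrix.mul_assoc _ C₁', hCC₁', Matrix.mul_one]
    have h1 := one_le_entryBound r
    have hRC_le : ∀ i j, |(R * C₁) i j| ≤ entryBound (r + 1) := fun i j =>
      (abs_mul_apply_le R C₁ hRb hb₁ (by norm_num) i j).trans
        ((mul_le_mul_of_nonneg_right (by exact_mod_cast hk) (by positivity)).trans
          (half_two_pow_mul_entryBound_le r))
    have hCR_le : ∀ i j, |(-(C₂' * R)) i j| ≤ entryBound (r + 1) := fun i j => by
      rw [Matrix.neg_apply, abs_neg]
      refine (abs_mul_apply_le C₂' R hb₂' hRb (by positivity) i j).trans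
        ((mul_le_mul_of_nonneg_right (Nat.cast_le.2 hl) (by positivity)).trans ?_)
      rw [mul_comm (entryBound r)]
      exact_mod_cast half_two_pow_mul_entryBound_le r
    have hup := entryBound_le_succ r
    have hbd : ∀ (X : Matrix (Fin k) (Fin k) ℝ) (Y : Matrix (Fin l) (Fin l) ℝ)
        (V : Matrix (Fin l) (Fin k) ℝ), (∀ i j, |X i j| ≤ entryBound r) →
        (∀ i j, |Y i j| ≤ entryBound r) → (∀ i j, |V i j| ≤ entryBound (r + 1)) →
        ∀ i j, |(fromBlocks X 0 V Y).submatrix e.symm e.symm i j| ≤ entryBound (r + 1) := by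
      intro X Y V hX hY hV i j
      rw [Matrix.submatrix_apply]
      rcases e.symm i with i | i <;> rcases e.symm j with j | j
      · exact (hX i j).trans hup
      · simpa using (zero_le_one.trans (one_le_entryBound (r + 1)))
      · exact hV i j
      · exact (hY i j).trans hup
    refine ⟨(fromBlocks T₁ 0 (-(Z * T₁)) T₂).submatrix e.symm e.symm,
      (fromBlocks T₁' 0 (T₂' * Z) T₂').submatrix e.symm e.symm,
      (fromBlocks C₁ 0 (R * C₁) C₂).submatrix e.symm e.symm,
      (fromBlocks C₁' 0 (-(C₂' * R)) C₂').submatrix e.symm e.symm,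
      ?_, ?_, ?_, isLower_submatrix_fromBlocks _ hlow₁ hlow₂,
      isLower_submatrix_fromBlocks _ hlow₁' hlow₂', hbd _ _ _ hb₁ hb₂ hRC_le,
      hbd _ _ _ hb₁' hb₂' hCR_le⟩
    · rw [Matrix.submatrix_mul_equiv, fromBlocks_multiply, hT₁, hT₂, ← Matrix.mul_assoc T₂, hT₂,
        Matrix.neg_mul, Matrix.mul_assoc, hT₁]
      simp
    · have hA' : A = (fromBlocks A₁ 0 E A₂).submatrix e.symm e.symm := by
        rw [← hblk]
        simp
      rw [hA', ← Matrix.submatrix_map, Matrix.submatrix_mul_equiv, fromBlocks_map,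
        fromBlocks_multiply, ← hRC]
      have hneg : (-(Z * T₁)).map (Int.cast : ℤ → ℝ) = 
          -(Z.map (Int.cast : ℤ → ℝ) * T₁.map (Int.cast : ℤ → ℝ)) := by
        rw [← map_intCast_mul]
        ext i j
        simp
      rw [hneg, Matrix.neg_mul, Matrix.mul_assoc _ (T₁.map (Int.cast : ℤ → ℝ)), ← hC₁, ← hC₂]
      congr 2
      · simp [hC₁]
      · simp
      · abel
      · simp
    · have h2 : C₂ * -(C₂' * R) = -R := by
        rw [Matrix.mul_neg, ← Matrix.mul_assoc, hCC₂, Matrix.one_mul]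
      rw [Matrix.submatrix_mul_equiv, fromBlocks_multiply, hCC₁, hCC₂, Matrix.mul_assoc R C₁, hCC₁,
        h2]
      simp

/-! ### Minimal integer vectors -/

/-- A positive definite quadratic form attains its minimum over the nonzero integer vectors. -/
theorem exists_minimal_int_vector {n : ℕ} {G : Matrix (Fin (n + 1)) (Fin (n + 1)) ℝ}
    (hG : G.PosDef) :
    ∃ x : Fin (n + 1) → ℤ, x ≠ 0 ∧ ∀ y : Fin (n + 1) → ℤ, y ≠ 0 →
      (fun i => (x i : ℝ)) ⬝ᵥ G *ᵥ (fun i => (x i : ℝ)) ≤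
        (fun i => (y i : ℝ)) ⬝ᵥ G *ᵥ (fun i => (y i : ℝ)) := by
  obtain ⟨b, c, hcb, hGb⟩ : ∃ b c : Matrix (Fin (n + 1)) (Fin (n + 1)) ℝ, c * b = 1 ∧
      G = bᵀ * b := by
    open scoped MatrixOrder in
    obtain ⟨b, hb, h⟩ := CStarAlgebra.isStrictlyPositive_iff_eq_star_mul_self.1
      hG.isStrictlyPositive
    obtain ⟨u, rfl⟩ := hb
    exact ⟨u, ↑u⁻¹, by simp, by simpa [Matrix.star_eq_conjTranspose] using h⟩
  set q : (Fin (n + 1) → ℤ) → ℝ :=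
    fun x => (fun i => (x i : ℝ)) ⬝ᵥ G *ᵥ (fun i => (x i : ℝ)) with hq
  have hqb : ∀ x, q x = ∑ j, (b *ᵥ (fun i => (x i : ℝ))) j ^ 2 := by
    intro x
    have := dotProduct_conj_mulVec bᵀ 1 (fun i => (x i : ℝ))
    rw [Matrix.mul_one, Matrix.transpose_transpose, ← hGb, Matrix.one_mulVec] at this
    rw [hq]
    simp only [this]
    simp only [dotProduct, sq]
  -- each coordinate of `x` is controlled by `q x`, since `x = c *ᵥ (b *ᵥ x)`
  have hcoord : ∀ x i, (x i : ℝ) ^ 2 ≤ (∑ j, c i j ^ 2) * q x := by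
    intro x i
    have hx : (x i : ℝ) = ∑ j, c i j * (b *ᵥ (fun i => (x i : ℝ))) j := by
      have : c *ᵥ (b *ᵥ (fun i => (x i : ℝ))) = fun i => (x i : ℝ) := by
        rw [Matrix.mulVec_mulVec, hcb, Matrix.one_mulVec]
      exact (congrFun this i).symm
    rw [hx, hqb]
    exact Finset.sum_mul_sq_le_sq_mul_sq _ _ _
  have hfin : ∀ R : ℝ, {x : Fin (n + 1) → ℤ | x ≠ 0 ∧ q x ≤ R}.Finite := by
    intro R
    set N : ℤ := ⌈∑ i, (∑ j, c i j ^ 2) * |R|⌉ with hN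
    refine (Set.finite_Icc (fun _ => -N) (fun _ => N)).subset ?_
    rintro x ⟨-, hx⟩
    have hle : ∀ i, x i ^ 2 ≤ N := by
      intro i
      have h1 : ∀ i, 0 ≤ ∑ j, c i j ^ 2 := fun i => Finset.sum_nonneg fun j _ => sq_nonneg _
      have h2 : (x i : ℝ) ^ 2 ≤ (∑ j, c i j ^ 2) * |R| :=
        (hcoord x i).trans (mul_le_mul_of_nonneg_left (hx.trans (le_abs_self R)) (h1 i))
      have h3 : (∑ j, c i j ^ 2) * |R| ≤ ∑ i, (∑ j, c i j ^ 2) * |R| :=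
        Finset.single_le_sum (f := fun i => (∑ j, c i j ^ 2) * |R|)
          (fun i _ => mul_nonneg (h1 i) (abs_nonneg R)) (Finset.mem_univ i)
      have h4 : ((x i ^ 2 : ℤ) : ℝ) ≤ (N : ℝ) := by
        push_cast
        exact h2.trans (h3.trans (Int.le_ceil _))
      exact_mod_cast h4
    constructor <;> intro i
    · have := hle i
      rcases le_or_gt 0 (x i) with h | h <;> simp only <;> nlinarith
    · have := hle i
      rcases le_or_gt (x i) 0 with h | h <;> simp only <;> nlinarith
  have hne : (1 : Fin (n + 1) → ℤ) ≠ 0 := one_ne_zero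
  obtain ⟨x, ⟨hx0, hx1⟩, hx⟩ := Set.exists_min_image _ q (hfin (q 1)) ⟨1, hne, le_rfl⟩
  refine ⟨x, hx0, fun y hy => ?_⟩
  rcases le_or_gt (q y) (q 1) with h | h
  · exact hx y ⟨hy, h⟩
  · exact hx1.trans h.le

/-- Every integer vector `x ≠ 0` is a multiple of the first row of a unimodular matrix: the Smith
normal form of `ℤ ∙ x` yields a basis of `ℤⁿ⁺¹` one of whose members is proportional to `x`. -/
theorem exists_unimodular_first_row {n : ℕ} {x : Fin (n + 1) → ℤ} (hx : x ≠ 0) :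
    ∃ (U U' : Matrix (Fin (n + 1)) (Fin (n + 1)) ℤ) (c : ℤ), U * U' = 1 ∧ x = c • U 0 := by
  obtain ⟨m, s⟩ := Submodule.smithNormalForm (Pi.basisFun ℤ (Fin (n + 1))) (Submodule.span ℤ {x})
  have hm : m ≠ 0 := by
    rintro rfl
    have hsub : Subsingleton (Submodule.span ℤ {x}) := s.bN.repr.toEquiv.subsingleton
    have := Subsingleton.elim (⟨x, Submodule.mem_span_singleton_self x⟩ : Submodule.span ℤ {x}) 0
    exact hx (congrArg Subtype.val this)
  set i₀ : Fin m := ⟨0, Nat.pos_of_ne_zero hm⟩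
  obtain ⟨z, hz⟩ := Submodule.mem_span_singleton.1 (s.bN i₀).2
  rw [s.snf] at hz
  have hz0 : z ≠ 0 := by
    rintro rfl
    rw [zero_smul, ← s.snf] at hz
    exact s.bN.ne_zero i₀ (Subtype.ext hz.symm)
  have hxb : x = s.bM.repr x (s.f i₀) • s.bM (s.f i₀) := by
    refine s.bM.repr.injective (Finsupp.ext fun i => ?_)
    by_cases hi : s.f i₀ = i
    · subst hi
      rw [map_smul]
      simp
    · have h := congrArg (fun v => s.bM.repr v i) hz
      simp only [map_smul, Finsupp.smul_apply, Module.Basis.repr_self, smul_eq_mul,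
        Finsupp.single_eq_of_ne' hi, mul_zero, mul_eq_zero, hz0, false_or] at h
      rw [map_smul, h]
      simp [Finsupp.single_eq_of_ne' hi]
  set b := s.bM.reindex (Equiv.swap (s.f i₀) 0) with hb
  set b₀ := Pi.basisFun ℤ (Fin (n + 1))
  refine ⟨(b₀.toMatrix b)ᵀ, (b.toMatrix b₀)ᵀ, s.bM.repr x (s.f i₀), ?_, ?_⟩
  · rw [← Matrix.transpose_mul, Module.Basis.toMatrix_mul_toMatrix_flip, Matrix.transpose_one]
  · have h0 : (b₀.toMatrix b)ᵀ 0 = s.bM (s.f i₀) := by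
      ext j
      simp [b₀, hb, Module.Basis.toMatrix_apply]
    rw [h0]
    exact hxb

/-! ### Minkowski's theorem and Hermite's inequality -/

/-- Minkowski's theorem on linear forms: the preimage of the cube of side `2 * c` under `P` has
volume at least `2 ^ K`, so it contains a nonzero integer vector. -/
theorem exists_int_vector_abs_mulVec_le {K : ℕ} (hK : 0 < K) {P : Matrix (Fin K) (Fin K) ℝ}
    (hP : P.det ≠ 0) {c : ℝ} (hc0 : 0 ≤ c) (hc : |P.det| ≤ c ^ K) :
    ∃ y : Fin K → ℤ, y ≠ 0 ∧ ∀ t, |(P *ᵥ fun i => (y i : ℝ)) t| ≤ c := by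
  have : Nonempty (Fin K) := ⟨⟨0, hK⟩⟩
  set f := Matrix.toLin' P with hf
  have hdet : LinearMap.det f = P.det := LinearMap.det_toLin' P
  have hdet0 : LinearMap.det f ≠ 0 := by rwa [hdet]
  set b := Pi.basisFun ℝ (Fin K)
  set s : Set (Fin K → ℝ) := f ⁻¹' Metric.closedBall 0 c with hs
  have hcpt : IsCompact s := by
    set e := (f.equivOfDetNeZero hdet0).toContinuousLinearEquiv.toHomeomorph
    exact (e.isCompact_preimage (s := Metric.closedBall 0 c)).2 (isCompact_closedBall _ _)
  have hconv : Convex ℝ s := (convex_closedBall 0 c).linear_preimage f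
  have hsymm : ∀ x ∈ s, -x ∈ s := fun x hx => by
    simpa [hs] using hx
  have hvol : MeasureTheory.volume (ZSpan.fundamentalDomain b) *
      2 ^ Module.finrank ℝ (Fin K → ℝ) ≤ MeasureTheory.volume s := by
    rw [hs, MeasureTheory.Measure.addHaar_preimage_linearMap _ hdet0, hdet,
      Real.volume_pi_closedBall _ hc0, ZSpan.volume_fundamentalDomain]
    have h1 : (Matrix.of b).det = 1 := by
      have : Matrix.of b = (1 : Matrix (Fin K) (Fin K) ℝ) := by
        ext i j
        simp [b, Matrix.one_apply, Pi.single_apply, eq_comm]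
      rw [this, Matrix.det_one]
    have hd : 0 < |P.det| := abs_pos.2 hP
    rw [h1, abs_one, ENNReal.ofReal_one, one_mul, Module.finrank_fintype_fun_eq_card,
      Fintype.card_fin, ← ENNReal.ofReal_mul (abs_nonneg _), mul_pow, abs_inv,
      show (2 : ENNReal) ^ K = ENNReal.ofReal (2 ^ K) by
        rw [ENNReal.ofReal_pow zero_le_two, ENNReal.ofReal_ofNat]]
    refine ENNReal.ofReal_le_ofReal ?_
    rw [inv_mul_eq_div, le_div_iff₀ hd]
    exact mul_le_mul_of_nonneg_left hc (by positivity)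
  have hcount : Countable (Submodule.span ℤ (Set.range b)).toAddSubgroup :=
    inferInstanceAs (Countable (Submodule.span ℤ (Set.range b)))
  have hdisc : DiscreteTopology (Submodule.span ℤ (Set.range b)).toAddSubgroup :=
    inferInstanceAs (DiscreteTopology (Submodule.span ℤ (Set.range b)))
  obtain ⟨x, hx0, hx⟩ :=
    MeasureTheory.exists_ne_zero_mem_lattice_of_measure_mul_two_pow_le_measure
      (L := (Submodule.span ℤ (Set.range b)).toAddSubgroup)
      (ZSpan.isAddFundamentalDomain b MeasureTheory.volume) hsymm hconv hcpt hvol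
  have hmem := (Module.Basis.mem_span_iff_repr_mem ℤ b (x : Fin K → ℝ)).1 x.2
  choose y hy using hmem
  have hxy : (x : Fin K → ℝ) = fun i => (y i : ℝ) := by
    ext i
    simpa [b] using (hy i).symm
  refine ⟨y, ?_, fun t => ?_⟩
  · rintro rfl
    refine hx0 (Subtype.ext ?_)
    rw [hxy]
    ext i
    simp
  · rw [hs, Set.mem_preimage, mem_closedBall_zero_iff, hxy, pi_norm_le_iff_of_nonneg hc0] at hx
    exact hx t

/-- If `a` is a lower bound for the form `M * diagonal D * Mᵀ` on nonzero integer vectors, then `a`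
satisfies Hermite's inequality, with constant `K` in dimension `K`, for every leading block. -/
theorem hermite_leading {N l : ℕ} (hl : l < N) {M : Matrix (Fin N) (Fin N) ℝ} (hM : IsLower M)
    (hM1 : ∀ i, M i i = 1) {D : ℕ → ℝ} (hD : ∀ i, 0 < D i) {a : ℝ} (ha : 0 ≤ a)
    (hmin : ∀ y : Fin N → ℤ, y ≠ 0 → a ≤ (fun i => (y i : ℝ)) ⬝ᵥ
      (M * diagonal (fun i : Fin N => D i) * Mᵀ) *ᵥ (fun i => (y i : ℝ))) :
    a ^ (l + 1) ≤ ((l : ℝ) + 1) ^ (l + 1) * ∏ i ∈ Finset.range (l + 1), D i := by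
  obtain ⟨p, rfl⟩ : ∃ p, N = (l + 1) + p := ⟨N - (l + 1), by omega⟩
  set P : Matrix (Fin (l + 1)) (Fin (l + 1)) ℝ :=
    Matrix.of fun t i => √(D t) * M (Fin.castAdd p i) (Fin.castAdd p t) with hP
  have hdet : P.det = ∏ t : Fin (l + 1), √(D t) := by
    rw [Matrix.det_of_isUpperTriangular]
    · simp [hP, hM1]
    · intro t i hti
      simp only [hP, Matrix.of_apply]
      rw [hM _ _ (show Fin.castAdd p i < Fin.castAdd p t from hti), mul_zero]
  have hprod : 0 < ∏ t : Fin (l + 1), √(D t) := Finset.prod_pos fun t _ => Real.sqrt_pos.2 (hD t)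
  -- the cube whose preimage under `P` has volume exactly `2 ^ (l + 1)`
  set c : ℝ := (∏ t : Fin (l + 1), √(D t)) ^ ((l + 1 : ℕ) : ℝ)⁻¹ with hc
  have hcpow : c ^ (l + 1) = ∏ t : Fin (l + 1), √(D t) :=
    Real.rpow_inv_natCast_pow hprod.le (by omega)
  have hc0 : 0 ≤ c := Real.rpow_nonneg hprod.le _
  obtain ⟨y, hy0, hy⟩ := exists_int_vector_abs_mulVec_le (Nat.succ_pos l) (P := P)
    (by rw [hdet]; exact hprod.ne') hc0 (by rw [hdet, abs_of_pos hprod]; exact hcpow.ge)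
  set y' : Fin (l + 1 + p) → ℤ := Fin.addCases y 0 with hy'
  have hy'0 : y' ≠ 0 := by
    intro h
    refine hy0 (funext fun i => ?_)
    simpa [hy'] using congrFun h (Fin.castAdd p i)
  have hsum : (fun i => (y' i : ℝ)) ⬝ᵥ
      (M * diagonal (fun i : Fin (l + 1 + p) => D i) * Mᵀ) *ᵥ (fun i => (y' i : ℝ)) =
        ∑ t, (P *ᵥ fun i => (y i : ℝ)) t ^ 2 := by
    have hv : ∀ t, (Mᵀ *ᵥ fun i => (y' i : ℝ)) t =
        ∑ i, M (Fin.castAdd p i) t * (y i : ℝ) := by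
      intro t
      simp [Matrix.mulVec, dotProduct, Fin.sum_univ_add, hy']
    rw [dotProduct_conj_mulVec]
    simp only [dotProduct, Matrix.mulVec_diagonal, hv]
    rw [Fin.sum_univ_add]
    have hz : ∀ t : Fin p, ∑ i, M (Fin.castAdd p i) (Fin.natAdd (l + 1) t) * (y i : ℝ) = 0 := by
      intro t
      refine Finset.sum_eq_zero fun i _ => ?_
      rw [hM _ _ (by simp only [Fin.lt_def, Fin.val_castAdd, Fin.val_natAdd]; omega), zero_mul]
    simp only [hz, mul_zero, Finset.sum_const_zero, add_zero]
    refine Finset.sum_congr rfl fun t _ => ?_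
    have : (P *ᵥ fun i => (y i : ℝ)) t =
        √(D t) * ∑ i, M (Fin.castAdd p i) (Fin.castAdd p t) * (y i : ℝ) := by
      simp [hP, Matrix.mulVec, dotProduct, Finset.mul_sum, mul_assoc]
    rw [this, mul_pow, Real.sq_sqrt (hD t).le, Fin.val_castAdd]
    ring
  have hle : a ≤ (l + 1) * c ^ 2 := by
    refine (hmin y' hy'0).trans ?_
    rw [hsum]
    refine (Finset.sum_le_card_nsmul _ _ (c ^ 2) fun t _ => ?_).trans (by simp)
    exact sq_le_sq' (abs_le.1 (hy t)).1 (abs_le.1 (hy t)).2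
  calc a ^ (l + 1) ≤ ((l + 1) * c ^ 2) ^ (l + 1) := pow_le_pow_left₀ ha hle _
    _ = ((l : ℝ) + 1) ^ (l + 1) * (c ^ (l + 1)) ^ 2 := by rw [mul_pow, pow_right_comm]
    _ = _ := by
      rw [hcpow, ← Finset.prod_pow, Finset.prod_range]
      simp only [Real.sq_sqrt (hD _).le]

/-! ### Hermite-Korkine-Zolotareff reduction -/

/-- The lower triangular block matrix with blocks `a`, `0`, `v` and `X`. -/
def borderLower {R : Type*} [Zero R] {n : ℕ} (a : R) (v : Fin n → R)
    (X : Matrix (Fin n) (Fin n) R) : Matrix (Fin (n + 1)) (Fin (n + 1)) R :=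
  Matrix.of (Fin.cons (Fin.cons a 0) fun i => Fin.cons (v i) (X i))

theorem borderLower_mul {R : Type*} [CommRing R] {n : ℕ} (a b : R) (v w : Fin n → R)
    (X Y : Matrix (Fin n) (Fin n) R) :
    borderLower a v X * borderLower b w Y = borderLower (a * b) (b • v + X *ᵥ w) (X * Y) := by
  ext i j
  refine Fin.cases ?_ (fun i => ?_) i <;> refine Fin.cases ?_ (fun j => ?_) j <;>
    simp [borderLower, Matrix.mul_apply, Fin.sum_univ_succ, Matrix.mulVec, dotProduct, mul_comm]

theorem borderLower_one {R : Type*} [CommRing R] {n : ℕ} :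
    borderLower 1 0 (1 : Matrix (Fin n) (Fin n) R) = 1 := by
  ext i j
  refine Fin.cases ?_ (fun i => ?_) i <;> refine Fin.cases ?_ (fun j => ?_) j <;>
    simp [borderLower, Matrix.one_apply, Fin.succ_ne_zero, (Fin.succ_ne_zero _).symm]

theorem borderLower_transpose {R : Type*} [CommRing R] {n : ℕ} (a : R)
    (X : Matrix (Fin n) (Fin n) R) : (borderLower a 0 X)ᵀ = borderLower a 0 Xᵀ := by
  ext i j
  refine Fin.cases ?_ (fun i => ?_) i <;> refine Fin.cases ?_ (fun j => ?_) j <;>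
    simp [borderLower]

theorem borderLower_map {n : ℕ} (a : ℤ) (v : Fin n → ℤ) (X : Matrix (Fin n) (Fin n) ℤ) :
    (borderLower a v X).map (Int.cast : ℤ → ℝ) =
      borderLower (a : ℝ) (fun i => (v i : ℝ)) (X.map (Int.cast : ℤ → ℝ)) := by
  ext i j
  refine Fin.cases ?_ (fun i => ?_) i <;> refine Fin.cases ?_ (fun j => ?_) j <;>
    simp [borderLower]

theorem isLower_borderLower {n : ℕ} (a : ℝ) (v : Fin n → ℝ) {X : Matrix (Fin n) (Fin n) ℝ}
    (hX : IsLower X) : IsLower (borderLower a v X) := by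
  intro i j
  refine Fin.cases ?_ (fun i => ?_) i <;> refine Fin.cases ?_ (fun j => ?_) j <;> intro h
  · exact absurd h (lt_irrefl _)
  · simp [borderLower]
  · exact absurd h (Fin.not_lt_zero _)
  · simpa [borderLower] using hX i j (Fin.succ_lt_succ_iff.1 h)

/-- The Schur complement step: `G = E * (G₀₀ ⊕ H) * Eᵀ` with `E` lower unitriangular and `H`
positive definite. -/
theorem exists_schur {n : ℕ} {G : Matrix (Fin (n + 1)) (Fin (n + 1)) ℝ} (hG : G.PosDef) :
    ∃ (w : Fin n → ℝ) (H : Matrix (Fin n) (Fin n) ℝ), H.PosDef ∧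
      G = borderLower 1 w 1 * borderLower (G 0 0) 0 H * (borderLower 1 w 1)ᵀ := by
  have ha : G 0 0 ≠ 0 := hG.diag_pos.ne'
  set w : Fin n → ℝ := fun i => G i.succ 0 / G 0 0 with hw
  have hEF : borderLower 1 w 1 * borderLower 1 (-w) (1 : Matrix (Fin n) (Fin n) ℝ) = 1 := by
    rw [borderLower_mul]
    simp [borderLower_one]
  have hFE : borderLower 1 (-w) 1 * borderLower 1 w (1 : Matrix (Fin n) (Fin n) ℝ) = 1 :=
    mul_eq_one_comm.1 hEF
  set E := borderLower 1 w (1 : Matrix (Fin n) (Fin n) ℝ) with hE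
  set F := borderLower 1 (-w) (1 : Matrix (Fin n) (Fin n) ℝ) with hF
  set K := F * G * Fᵀ with hK
  have hKpd : K.PosDef := posDef_conj hG hFE
  have hKsymm : ∀ i j, K i j = K j i := fun i j => by
    simpa using hKpd.isHermitian.apply j i
  have hK0 : K 0 0 = G 0 0 := by
    simp [hK, hF, borderLower, Matrix.mul_apply, Fin.sum_univ_succ]
  have hKs : ∀ i : Fin n, K i.succ 0 = 0 := fun i => by
    simp [hK, hF, borderLower, Matrix.mul_apply, Fin.sum_univ_succ, Matrix.one_apply, hw]
    field_simp
    ring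
  refine ⟨w, K.submatrix Fin.succ Fin.succ, hKpd.submatrix (Fin.succ_injective n), ?_⟩
  have hKb : borderLower (G 0 0) 0 (K.submatrix Fin.succ Fin.succ) = K := by
    ext i j
    refine Fin.cases ?_ (fun i => ?_) i <;> refine Fin.cases ?_ (fun j => ?_) j
    · simp [borderLower, hK0]
    · simp [borderLower, hKsymm 0 j.succ, hKs]
    · simp [borderLower, hKs]
    · simp [borderLower]
  rw [hKb, hK]
  calc G = (E * F) * G * (E * F)ᵀ := by rw [hEF]; simp
    _ = E * (F * G * Fᵀ) * Eᵀ := by simp only [Matrix.transpose_mul, Matrix.mul_assoc]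

/-- Hermite-Korkine-Zolotareff reduction of a positive definite form: after a unimodular change of
variables, the form is `M * diagonal D * Mᵀ` with `M` lower unitriangular, and each `D j` satisfies
Hermite's inequality for all blocks of consecutive indices that start at `j`. The profile `D` is
indexed by `ℕ`, with irrelevant positive values from `n` on. -/
theorem exists_hkz (n : ℕ) : ∀ G : Matrix (Fin n) (Fin n) ℝ, G.PosDef →
    ∃ (U U' : Matrix (Fin n) (Fin n) ℤ) (M : Matrix (Fin n) (Fin n) ℝ) (D : ℕ → ℝ),
      U * U' = 1 ∧ IsLower M ∧ (∀ i, M i i = 1) ∧ (∀ i, 0 < D i) ∧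
      U.map (Int.cast : ℤ → ℝ) * G * (U.map (Int.cast : ℤ → ℝ))ᵀ =
        M * diagonal (fun i : Fin n => D i) * Mᵀ ∧
      ∀ j l, j + l < n →
        D j ^ (l + 1) ≤ ((l : ℝ) + 1) ^ (l + 1) * ∏ i ∈ Finset.range (l + 1), D (j + i) := by
  induction n with
  | zero =>
    intro G _
    exact ⟨1, 1, 1, fun _ => 1, by simp, fun i => i.elim0, fun i => i.elim0,
      fun _ => zero_lt_one, by ext i; exact i.elim0, fun j l h => absurd h (by omega)⟩
  | succ n ih =>
    intro G hG
    obtain ⟨x, hx0, hx⟩ := exists_minimal_int_vector hG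
    obtain ⟨U₁, U₁', c, hU₁, hxc⟩ := exists_unimodular_first_row hx0
    set V₁ := U₁.map (Int.cast : ℤ → ℝ) with hV₁
    set G₁ := V₁ * G * V₁ᵀ with hG₁
    have hG₁pd : G₁.PosDef := posDef_conj hG (map_intCast_mul_eq_one hU₁)
    have ha : 0 < G₁ 0 0 := hG₁pd.diag_pos
    have hrow : G₁ 0 0 = (fun i => (U₁ 0 i : ℝ)) ⬝ᵥ G *ᵥ (fun i => (U₁ 0 i : ℝ)) := by
      simp only [hG₁, hV₁, Matrix.mul_apply, dotProduct, Matrix.mulVec, Matrix.map_apply,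
        Matrix.transpose_apply, Finset.mul_sum, Finset.sum_mul]
      rw [Finset.sum_comm]
      simp only [mul_assoc]
    -- the first row of `U₁` divides the minimal vector `x`, so it is minimal as well
    have hmin : ∀ y : Fin (n + 1) → ℤ, y ≠ 0 →
        G₁ 0 0 ≤ (fun i => (y i : ℝ)) ⬝ᵥ G *ᵥ (fun i => (y i : ℝ)) := by
      intro y hy
      refine le_trans ?_ (hx y hy)
      have hc : c ≠ 0 := by
        rintro rfl
        exact hx0 (by simpa using hxc)
      have hc1 : (1 : ℝ) ≤ (c : ℝ) ^ 2 := by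
        have : 1 ≤ c ^ 2 := Int.add_one_le_of_lt (sq_pos_iff.2 hc)
        exact_mod_cast this
      have hxr : (fun i => (x i : ℝ)) = (c : ℝ) • fun i => (U₁ 0 i : ℝ) := by
        ext i
        rw [hxc]
        simp
      rw [hxr, Matrix.mulVec_smul, dotProduct_smul, smul_dotProduct, ← hrow, smul_eq_mul,
        smul_eq_mul]
      nlinarith
    obtain ⟨w, H, hH, hG₁H⟩ := exists_schur hG₁pd
    obtain ⟨U₂, U₂', M₂, D₂, hU₂, hM₂, hM₂1, hD₂, hUH, hherm⟩ := ih H hH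
    set V₂ := U₂.map (Int.cast : ℤ → ℝ) with hV₂
    set D : ℕ → ℝ := fun i => Nat.casesOn i (G₁ 0 0) D₂ with hDdef
    have hD : ∀ i, 0 < D i := fun i => by
      cases i with
      | zero => exact ha
      | succ i => exact hD₂ i
    set M := borderLower 1 (V₂ *ᵥ w) M₂ with hM
    have hMlow : IsLower M := isLower_borderLower _ _ hM₂
    have hM1 : ∀ i, M i i = 1 := fun i => by
      refine Fin.cases ?_ (fun i => ?_) i
      · simp [hM, borderLower]
      · simp [hM, borderLower, hM₂1]
    have hUU : borderLower 1 0 U₂ * U₁ * (U₁' * borderLower 1 0 U₂') = 1 := by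
      rw [Matrix.mul_assoc, ← Matrix.mul_assoc U₁, hU₁, Matrix.one_mul, borderLower_mul, hU₂]
      simp [borderLower_one]
    set V := (borderLower 1 0 U₂ * U₁).map (Int.cast : ℤ → ℝ) with hV
    have hVmul : V = borderLower 1 0 V₂ * V₁ := by
      rw [hV, map_intCast_mul, borderLower_map]
      simp [hV₂, hV₁, Pi.zero_def]
    have hdiag : diagonal (fun i : Fin (n + 1) => D i) =
        borderLower (G₁ 0 0) 0 (diagonal fun i : Fin n => D₂ i) := by
      ext i j
      refine Fin.cases ?_ (fun i => ?_) i <;> refine Fin.cases ?_ (fun j => ?_) j <;>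
        simp [borderLower, Matrix.diagonal_apply, hDdef, Fin.succ_ne_zero,
          (Fin.succ_ne_zero _).symm]
    have hdecomp : V * G * Vᵀ = M * diagonal (fun i : Fin (n + 1) => D i) * Mᵀ := by
      have hMmul : M = borderLower 1 (V₂ *ᵥ w) 1 * borderLower 1 0 M₂ := by
        rw [borderLower_mul, hM]
        simp
      have hWE : borderLower 1 0 V₂ * borderLower 1 w 1 =
          borderLower 1 (V₂ *ᵥ w) 1 * borderLower 1 0 V₂ := by
        rw [borderLower_mul, borderLower_mul]
        simp
      have hmid : borderLower 1 0 V₂ * borderLower (G₁ 0 0) 0 H * (borderLower 1 0 V₂)ᵀ =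
          borderLower 1 0 M₂ * diagonal (fun i : Fin (n + 1) => D i) * (borderLower 1 0 M₂)ᵀ := by
        rw [hdiag, borderLower_transpose, borderLower_transpose]
        simp only [borderLower_mul, hUH]
        simp
      calc V * G * Vᵀ = borderLower 1 0 V₂ * G₁ * (borderLower 1 0 V₂)ᵀ := by
            rw [hVmul, hG₁]
            simp only [Matrix.transpose_mul, Matrix.mul_assoc]
        _ = (borderLower 1 0 V₂ * borderLower 1 w 1) * borderLower (G₁ 0 0) 0 H *
              (borderLower 1 0 V₂ * borderLower 1 w 1)ᵀ := by
            conv_lhs => rw [hG₁H]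
            simp only [Matrix.transpose_mul, Matrix.mul_assoc]
        _ = borderLower 1 (V₂ *ᵥ w) 1 *
              (borderLower 1 0 V₂ * borderLower (G₁ 0 0) 0 H * (borderLower 1 0 V₂)ᵀ) *
              (borderLower 1 (V₂ *ᵥ w) 1)ᵀ := by
            rw [hWE]
            simp only [Matrix.transpose_mul, Matrix.mul_assoc]
        _ = _ := by
            rw [hmid, hMmul]
            simp only [Matrix.transpose_mul, Matrix.mul_assoc]
    refine ⟨borderLower 1 0 U₂ * U₁, U₁' * borderLower 1 0 U₂', M, D, hUU, hMlow, hM1, hD,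
      hdecomp, ?_⟩
    intro j l hjl
    cases j with
    | zero =>
      simp only [zero_add] at hjl ⊢
      refine hermite_leading hjl hMlow hM1 hD ha.le fun y hy => ?_
      rw [← hdecomp, dotProduct_conj_mulVec]
      set W := borderLower 1 0 U₂ * U₁ with hW
      have hcast : (Vᵀ *ᵥ fun i => (y i : ℝ)) = fun i => ((Wᵀ *ᵥ y) i : ℝ) := by
        ext i
        simp [hV, Matrix.mulVec, dotProduct]
      rw [hcast]
      refine hmin _ fun h0 => hy ?_
      have hinv : (U₁' * borderLower 1 0 U₂')ᵀ * Wᵀ = 1 := by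
        rw [← Matrix.transpose_mul, hUU, Matrix.transpose_one]
      rw [← Matrix.one_mulVec y, ← hinv, ← Matrix.mulVec_mulVec, h0, Matrix.mulVec_zero]
    | succ j =>
      have := hherm j l (by omega)
      simpa [hDdef, Nat.succ_add, Nat.add_right_comm j 1] using this

/-! ### Decay of the Gram-Schmidt profile -/

/-- The sum of `log i / (i - 1)` over `2 ≤ i ≤ t + 1`. Hermite's inequality in dimension `i`, with
constant `i`, can raise the logarithm of the geometric mean of a profile by `log i / (i - 1)`. -/
noncomputable def hermiteSum (t : ℕ) : ℝ :=
  ∑ i ∈ Finset.range t, Real.log (i + 2) / (i + 1)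

theorem hermiteSum_succ (t : ℕ) :
    hermiteSum (t + 1) = hermiteSum t + Real.log (t + 2) / (t + 1) :=
  Finset.sum_range_succ _ _

theorem hermiteSum_mono : Monotone hermiteSum :=
  monotone_nat_of_le_succ fun t => by
    rw [hermiteSum_succ]
    have : 0 ≤ Real.log ((t : ℝ) + 2) := Real.log_nonneg (by linarith [t.cast_nonneg (α := ℝ)])
    have : 0 ≤ Real.log ((t : ℝ) + 2) / (t + 1) := by positivity
    linarith

theorem hermiteSum_le (t : ℕ) : hermiteSum t ≤ Real.log (t + 1) ^ 2 + Real.log 2 := by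
  induction t with
  | zero => simp [hermiteSum, Real.log_nonneg]
  | succ t ih =>
    rcases t with _ | t
    · norm_num [hermiteSum]
      positivity
    · rw [hermiteSum_succ]
      push_cast at ih ⊢
      rw [show (t : ℝ) + 1 + 1 = t + 2 by ring] at *
      rw [show (t : ℝ) + 1 + 2 = t + 3 by ring, show (t : ℝ) + 2 + 1 = t + 3 by ring]
      have ht : (0 : ℝ) ≤ t := t.cast_nonneg
      set a := Real.log ((t : ℝ) + 2)
      set b := Real.log ((t : ℝ) + 3)
      have ha : 0 ≤ a := Real.log_nonneg (by linarith)
      have hb : 0 ≤ b := Real.log_nonneg (by linarith)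
      -- `log (1 + 1 / (t + 2)) ≥ 1 / (t + 3)`
      have hstep : 1 / ((t : ℝ) + 3) ≤ b - a := by
        have := Real.one_sub_inv_le_log_of_pos (show (0 : ℝ) < (t + 3) / (t + 2) by positivity)
        rw [Real.log_div (by positivity) (by positivity), inv_div] at this
        refine le_trans (le_of_eq ?_) this
        field_simp
        ring
      -- `t + 3 ≤ (t + 2) ^ (t + 2)`
      have hpow : b ≤ (t + 2) * a := by
        have h2 : b ≤ 2 * a := by
          rw [show 2 * a = Real.log (((t : ℝ) + 2) ^ 2) by rw [Real.log_pow]; norm_num [a]]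
          exact Real.log_le_log (by positivity) (by nlinarith)
        nlinarith
      have key : b / (t + 2) ≤ (b - a) * (b + a) := by
        refine le_trans ?_ (mul_le_mul_of_nonneg_right hstep (by positivity))
        rw [div_mul_eq_mul_div, one_mul, div_le_div_iff₀ (by positivity) (by positivity)]
        nlinarith
      nlinarith

/-- If, for `t ≤ N`, the term `x t` of a positive sequence is at most `t + 1` times the geometric
mean of `x 0, …, x t`, then `log (x N / x 0)` is at most `log (N + 1) + hermiteSum N`. The
logarithms `g` of the normalized terms have mean at most `hermiteSum t` over the indices up to
`t`. -/
theorem log_le_of_hermite {x : ℕ → ℝ} (hx : ∀ s, 0 < x s) {N : ℕ}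
    (h : ∀ t ≤ N, x t ^ (t + 1) ≤ ((t : ℝ) + 1) ^ (t + 1) * ∏ s ∈ Finset.range (t + 1), x s) :
    Real.log (x N) ≤ Real.log (x 0) + Real.log (N + 1) + hermiteSum N := by
  set g : ℕ → ℝ := fun s => Real.log (x s) - Real.log (x 0) with hg
  have hlog : ∀ t ≤ N, (t + 1) * g t ≤
      (t + 1) * Real.log (t + 1) + ∑ s ∈ Finset.range (t + 1), g s := by
    intro t ht
    have := Real.log_le_log (pow_pos (hx t) _) (h t ht)
    rw [Real.log_mul (by positivity) (Finset.prod_ne_zero_iff.2 fun s _ => (hx s).ne'),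
      Real.log_pow, Real.log_pow, Real.log_prod fun s _ => (hx s).ne'] at this
    simp only [hg, Finset.sum_sub_distrib, Finset.sum_const, Finset.card_range, nsmul_eq_mul]
    push_cast at this ⊢
    linarith
  -- the term `g (t + 1)` on the right of `hlog` is absorbed on the left
  have hstep : ∀ t, t + 1 ≤ N → (t + 1) * g (t + 1) ≤
      (t + 2) * Real.log (t + 2) + ∑ s ∈ Finset.range (t + 1), g s := by
    intro t ht
    have := hlog (t + 1) ht
    rw [Finset.sum_range_succ] at this
    push_cast at this
    rw [show (t : ℝ) + 1 + 1 = t + 2 by ring] at this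
    linarith
  have hsum : ∀ t ≤ N, ∑ s ∈ Finset.range (t + 1), g s ≤ (t + 1) * hermiteSum t := by
    intro t
    induction t with
    | zero => simp [hg, hermiteSum]
    | succ t ih =>
      intro ht
      have h1 := hstep t ht
      have h2 := ih (by omega)
      rw [Finset.sum_range_succ, hermiteSum_succ]
      have ht' : (0 : ℝ) < t + 1 := by positivity
      refine le_of_mul_le_mul_left ?_ ht'
      have h3 : ((t : ℝ) + 1) * (((t + 1 : ℕ) + 1) * (hermiteSum t + Real.log (t + 2) / (t + 1)))
          = (t + 2) * ((t + 1) * hermiteSum t) + (t + 2) * Real.log (t + 2) := by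
        push_cast
        field_simp
        ring
      rw [h3]
      nlinarith
  suffices g N ≤ Real.log (N + 1) + hermiteSum N by
    simp only [hg] at this
    linarith
  rcases N with _ | t
  · simp [hg, hermiteSum]
  · have h1 := hstep t le_rfl
    have h2 := hsum t (by omega)
    rw [hermiteSum_succ]
    push_cast
    rw [show (t : ℝ) + 1 + 1 = t + 2 by ring]
    have ht' : (0 : ℝ) < t + 1 := by positivity
    refine le_of_mul_le_mul_left ?_ ht'
    have h3 : ((t : ℝ) + 1) * (Real.log (t + 2) + (hermiteSum t + Real.log (t + 2) / (t + 1)))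
        = (t + 1) * hermiteSum t + (t + 2) * Real.log (t + 2) := by
      field_simp
      ring
    rw [h3]
    linarith

/-- The exponents of all factors other than powers of `n` fit into the claimed bound. With
`r = ⌈log₂ n⌉ - 1`, so that `r * log 2 ≤ log n`, the term `log 2` in `hermiteSum_le` is absorbed by
`2 * r * (r - 1) + 1 ≤ 2 * r ^ 2` for `r ≥ 1`, and by `log 2 ≤ log n` for `r = 0`. For
`n = 1` both sides vanish. -/
theorem entryBound_exponent_le {n : ℕ} (hn : 1 ≤ n) {N : ℕ} (hN : N + 1 = n) :
    4 * (((Nat.clog 2 n - 1).choose 2 : ℕ) * Real.log 2) + hermiteSum N ≤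
      (2 / Real.log 2 + 1) * Real.log n ^ 2 := by
  have hl2 : 0 < Real.log 2 := Real.log_pos one_lt_two
  rcases hn.eq_or_lt with rfl | hn
  · obtain rfl : N = 0 := by omega
    simp [hermiteSum]
  have hE : hermiteSum N ≤ Real.log n ^ 2 + Real.log 2 := by
    rw [← hN]
    exact_mod_cast hermiteSum_le N
  obtain ⟨r, hr⟩ : ∃ r, Nat.clog 2 n = r + 1 :=
    Nat.exists_eq_succ_of_ne_zero (Nat.clog_pos one_lt_two hn).ne'
  have hr_lt : 2 ^ r < n := by
    have := Nat.pow_pred_clog_lt_self one_lt_two hn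
    rwa [hr] at this
  have h1 : r * Real.log 2 ≤ Real.log n := by
    rw [← Real.log_pow]
    exact Real.log_le_log (by positivity) (by exact_mod_cast hr_lt.le)
  have h2 : Real.log 2 ≤ Real.log n :=
    Real.log_le_log (by positivity) (by exact_mod_cast hn)
  have hch : 2 * ((r.choose 2 : ℕ) : ℝ) = r * (r - 1) := by
    rw [Nat.cast_choose_two]
    ring
  rw [hr, Nat.add_sub_cancel]
  have key : 2 * (r * (r - 1)) * Real.log 2 + Real.log 2 ≤ 2 / Real.log 2 * Real.log n ^ 2 := by
    rw [div_mul_eq_mul_div, le_div_iff₀ hl2]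
    rcases r with _ | r
    · push_cast
      nlinarith
    · push_cast at h1 ⊢
      have hr0 : (0 : ℝ) ≤ r := r.cast_nonneg
      have : (((r : ℝ) + 1) * Real.log 2) ^ 2 ≤ Real.log n ^ 2 :=
        pow_le_pow_left₀ (by positivity) h1 2
      nlinarith [mul_nonneg hr0 (sq_nonneg (Real.log 2)), sq_nonneg (Real.log 2)]
  nlinarith

/-! ### Reduction of positive definite forms -/

theorem profile_ratio_le {n : ℕ} {D : ℕ → ℝ} (hD : ∀ i, 0 < D i)
    (h : ∀ j l, j + l < n →
      D j ^ (l + 1) ≤ ((l : ℝ) + 1) ^ (l + 1) * ∏ i ∈ Finset.range (l + 1), D (j + i))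
    {j k : ℕ} (hjk : j ≤ k) (hk : k < n) :
    D j * (D k)⁻¹ ≤ n * Real.exp (hermiteSum (n - 1)) := by
  have hn : (0 : ℝ) < n := by exact_mod_cast (by omega : 0 < n)
  -- the profile is read backwards from the index `k`
  have hlog := log_le_of_hermite (x := fun t => D (k - t)) (fun t => hD _) (N := k - j) (by
    intro t ht
    have h1 := h (k - t) t (by omega)
    refine h1.trans (le_of_eq ?_)
    congr 1
    rw [← Finset.prod_range_reflect]
    refine Finset.prod_congr rfl fun s hs => ?_
    rw [Finset.mem_range] at hs
    congr 1
    omega)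
  simp only [Nat.sub_sub_self hjk, Nat.sub_zero] at hlog
  have h1 : Real.log ((k - j : ℕ) + 1) ≤ Real.log n :=
    Real.log_le_log (by positivity) (by exact_mod_cast (by omega : k - j + 1 ≤ n))
  have h2 : hermiteSum (k - j) ≤ hermiteSum (n - 1) := hermiteSum_mono (by omega)
  rw [← div_eq_mul_inv, div_le_iff₀ (hD k)]
  calc D j = Real.exp (Real.log (D j)) := (Real.exp_log (hD j)).symm
    _ ≤ Real.exp (Real.log n + hermiteSum (n - 1) + Real.log (D k)) :=
        Real.exp_le_exp.2 (by linarith)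
    _ = _ := by rw [Real.exp_add, Real.exp_add, Real.exp_log hn, Real.exp_log (hD k)]

/-- The Seysen measure of a triangular factorization: in
`∑ i j k, C i j ^ 2 * C' k i ^ 2 * d j / d k` only the terms with `j ≤ i ≤ k` survive, so it
suffices to bound `d j / d k` for `j ≤ k`. -/
theorem sum_diag_mul_diag_inv_le {n : ℕ} {C C' : Matrix (Fin n) (Fin n) ℝ} {d : Fin n → ℝ}
    (hd : ∀ i, 0 < d i) (hCC : C * C' = 1) (hC : IsLower C) (hC' : IsLower C') {g ρ : ℝ}
    (hg : ∀ i j, |C i j| ≤ g) (hg' : ∀ i j, |C' i j| ≤ g) (hρ0 : 0 ≤ ρ)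
    (hρ : ∀ j k, j ≤ k → d j * (d k)⁻¹ ≤ ρ) :
    ∑ i, (C * diagonal d * Cᵀ) i i * (C * diagonal d * Cᵀ)⁻¹ i i ≤ (n : ℝ) ^ 3 * (g ^ 4 * ρ) := by
  have hinv : (C * diagonal d * Cᵀ)⁻¹ = C'ᵀ * diagonal (fun k => (d k)⁻¹) * C' := by
    refine Matrix.inv_eq_right_inv ?_
    have h1 : Cᵀ * C'ᵀ = 1 := by
      rw [← Matrix.transpose_mul, mul_eq_one_comm.1 hCC, Matrix.transpose_one]
    have h2 : diagonal d * diagonal (fun k => (d k)⁻¹) = 1 := by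
      rw [Matrix.diagonal_mul_diagonal]
      simp [(hd _).ne']
    calc C * diagonal d * Cᵀ * (C'ᵀ * diagonal (fun k => (d k)⁻¹) * C')
        = C * (diagonal d * (Cᵀ * C'ᵀ) * diagonal (fun k => (d k)⁻¹)) * C' := by
          simp only [Matrix.mul_assoc]
      _ = 1 := by rw [h1, Matrix.mul_one, h2, Matrix.mul_one, hCC]
  have hterm : ∀ i j k, C i j * d j * C i j * (C' k i * (d k)⁻¹ * C' k i) ≤ g ^ 4 * ρ := by
    intro i j k
    have hnn : 0 ≤ g ^ 4 * ρ := mul_nonneg (by positivity) hρ0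
    rcases lt_or_ge i j with hij | hji
    · simpa [hC i j hij] using hnn
    rcases lt_or_ge k i with hki | hik
    · simpa [hC' k i hki] using hnn
    have h1 : C i j ^ 2 ≤ g ^ 2 := sq_le_sq' (abs_le.1 (hg i j)).1 (abs_le.1 (hg i j)).2
    have h2 : C' k i ^ 2 ≤ g ^ 2 := sq_le_sq' (abs_le.1 (hg' k i)).1 (abs_le.1 (hg' k i)).2
    calc C i j * d j * C i j * (C' k i * (d k)⁻¹ * C' k i)
        = C i j ^ 2 * C' k i ^ 2 * (d j * (d k)⁻¹) := by ring
      _ ≤ g ^ 2 * g ^ 2 * ρ :=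
          mul_le_mul (mul_le_mul h1 h2 (sq_nonneg _) (sq_nonneg _)) (hρ j k (hji.trans hik))
            (mul_nonneg (hd j).le (inv_nonneg.2 (hd k).le)) (by positivity)
      _ = g ^ 4 * ρ := by ring
  rw [hinv]
  have hsum : ∀ i, (C * diagonal d * Cᵀ) i i * (C'ᵀ * diagonal (fun k => (d k)⁻¹) * C') i i =
      ∑ j, ∑ k, C i j * d j * C i j * (C' k i * (d k)⁻¹ * C' k i) := by
    intro i
    rw [Matrix.mul_apply, Matrix.mul_apply, Finset.sum_mul_sum]
    simp only [Matrix.mul_diagonal, Matrix.transpose_apply]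
  calc _ ≤ ∑ _i : Fin n, ∑ _j : Fin n, ∑ _k : Fin n, g ^ 4 * ρ := by
        refine Finset.sum_le_sum fun i _ => ?_
        rw [hsum]
        exact Finset.sum_le_sum fun j _ => Finset.sum_le_sum fun k _ => hterm i j k
    _ = (n : ℝ) ^ 3 * (g ^ 4 * ρ) := by
        simp only [Finset.sum_const, Finset.card_univ, Fintype.card_fin, nsmul_eq_mul]
        ring

/-- Every positive definite form is integrally equivalent to one with small Seysen measure. -/
theorem exists_unimodular_seysen_le {n : ℕ} (hn : 1 ≤ n) {G : Matrix (Fin n) (Fin n) ℝ}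
    (hG : G.PosDef) :
    ∃ V V' : Matrix (Fin n) (Fin n) ℤ, V * V' = 1 ∧
      ∑ i, (V.map (Int.cast : ℤ → ℝ) * G * (V.map (Int.cast : ℤ → ℝ))ᵀ) i i *
        (V.map (Int.cast : ℤ → ℝ) * G * (V.map (Int.cast : ℤ → ℝ))ᵀ)⁻¹ i i ≤
          Real.exp ((2 / Real.log 2 + 1) * Real.log n ^ 2 + 4 * Real.log n) := by
  obtain ⟨U, U', M, D, hU, hM, hM1, hD, hdec, hherm⟩ := exists_hkz n G hG
  obtain ⟨T, T', C, C', hT, hC, hCC, hlow, hlow', hb, hb'⟩ :=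
    exists_unimodular_mul_bounded (Nat.clog 2 n) n (Nat.le_pow_clog one_lt_two n) M hM hM1
  refine ⟨T * U, U' * T', ?_, ?_⟩
  · rw [Matrix.mul_assoc, ← Matrix.mul_assoc U, hU, Matrix.one_mul, hT]
  have hfac : (T * U).map (Int.cast : ℤ → ℝ) * G * ((T * U).map (Int.cast : ℤ → ℝ))ᵀ =
      C * diagonal (fun i : Fin n => D i) * Cᵀ := by
    rw [map_intCast_mul, hC]
    calc _ = T.map (Int.cast : ℤ → ℝ) *
          (U.map (Int.cast : ℤ → ℝ) * G * (U.map (Int.cast : ℤ → ℝ))ᵀ) *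
          (T.map (Int.cast : ℤ → ℝ))ᵀ := by
          simp only [Matrix.transpose_mul, Matrix.mul_assoc]
      _ = _ := by
          rw [hdec]
          simp only [Matrix.transpose_mul, Matrix.mul_assoc]
  rw [hfac]
  have hn0 : (0 : ℝ) < n := by exact_mod_cast hn
  refine (sum_diag_mul_diag_inv_le (fun i => hD i) hCC hlow hlow' hb hb'
    (ρ := n * Real.exp (hermiteSum (n - 1))) (by positivity)
    (fun j k hjk => profile_ratio_le hD hherm hjk k.2)).trans ?_
  have hbound : entryBound (Nat.clog 2 n) =
      Real.exp (((Nat.clog 2 n - 1).choose 2 : ℕ) * Real.log 2) := by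
    rw [Real.exp_nat_mul, Real.exp_log two_pos, entryBound]
  have hnexp : (n : ℝ) = Real.exp (Real.log n) := (Real.exp_log hn0).symm
  have hnum := entryBound_exponent_le hn (N := n - 1) (by omega)
  calc _ = Real.exp (4 * (((Nat.clog 2 n - 1).choose 2 : ℕ) * Real.log 2) + hermiteSum (n - 1) +
          4 * Real.log n) := by
        rw [Real.exp_add, Real.exp_add, hbound, ← Real.exp_nat_mul]
        rw [show Real.exp (4 * Real.log n) = (n : ℝ) ^ 4 by
          rw [show (4 : ℝ) * Real.log n = (4 : ℕ) * Real.log n by norm_num, Real.exp_nat_mul,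
            ← hnexp]]
        push_cast
        ring
    _ ≤ _ := Real.exp_le_exp.2 (by linarith)

/-! ### Lattice bases and Gram matrices -/

theorem norm_rowVec_sq {n m : ℕ} (B : Matrix (Fin n) (Fin m) ℝ) (i : Fin n) :
    ‖rowVec B i‖ ^ 2 = (B * Bᵀ) i i := by
  rw [EuclideanSpace.norm_sq_eq, Matrix.mul_apply]
  refine Finset.sum_congr rfl fun j _ => ?_
  simp [rowVec, sq]

/-- The Gram matrix of the dual basis is the inverse of the Gram matrix. -/
theorem seysenMeasure_eq {n m : ℕ} {B : Matrix (Fin n) (Fin m) ℝ}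
    (hB : LinearIndependent ℝ (rowVec B)) :
    seysenMeasure B = ∑ i, (B * Bᵀ) i i * (B * Bᵀ)⁻¹ i i := by
  have hdual : dualBasis B * (dualBasis B)ᵀ = (B * Bᵀ)⁻¹ := by
    have h : dualBasis B = (B * Bᵀ)⁻¹ * B := by
      rw [dualBasis, Matrix.transpose_mul, Matrix.transpose_transpose,
        Matrix.transpose_nonsing_inv, Matrix.transpose_mul, Matrix.transpose_transpose]
    conv_lhs => rw [h, Matrix.mul_assoc]
    rw [← h, mul_transpose_dualBasis hB, Matrix.mul_one]
  simp only [seysenMeasure, norm_rowVec_sq, hdual]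

theorem linearIndependent_rowVec_of_mul_eq_one {n m : ℕ} {B : Matrix (Fin n) (Fin m) ℝ}
    {P : Matrix (Fin m) (Fin n) ℝ} (h : B * P = 1) : LinearIndependent ℝ (rowVec B) := by
  rw [Fintype.linearIndependent_iff]
  intro c hc
  have hcB : c ᵥ* B = 0 := by
    ext j
    have := congrArg (fun v : EuclideanSpace ℝ (Fin m) => v j) hc
    simpa [rowVec, Matrix.vecMul, dotProduct] using this
  have : c = 0 := by
    rw [← Matrix.vecMul_one c, ← h, ← Matrix.vecMul_vecMul, hcB, Matrix.zero_vecMul]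
  exact fun i => congrFun this i

theorem posDef_gram {n m : ℕ} {B : Matrix (Fin n) (Fin m) ℝ} {P : Matrix (Fin m) (Fin n) ℝ}
    (h : B * P = 1) : (B * Bᵀ).PosDef := by
  have := Matrix.PosDef.mul_conjTranspose_self B (fun x y hxy => by
    have h' := congrArg (· ᵥ* P) hxy
    simpa [Matrix.vecMul_vecMul, h] using h')
  simpa using this

theorem span_rowVec_mul_le {n m : ℕ} (V : Matrix (Fin n) (Fin n) ℤ)
    (B : Matrix (Fin n) (Fin m) ℝ) :
    Submodule.span ℤ (Set.range (rowVec (V.map (Int.cast : ℤ → ℝ) * B))) ≤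
      Submodule.span ℤ (Set.range (rowVec B)) := by
  rw [Submodule.span_le]
  rintro _ ⟨i, rfl⟩
  have : rowVec (V.map (Int.cast : ℤ → ℝ) * B) i = ∑ j, V i j • rowVec B j := by
    ext s
    simp [rowVec, Matrix.mul_apply]
  rw [SetLike.mem_coe, this]
  exact Submodule.sum_mem _ fun j _ =>
    Submodule.smul_mem _ _ (Submodule.subset_span (Set.mem_range_self j))

end SeysenMeasure

theorem proposition2p2 (n m : ℕ) (hn : 1 ≤ n) (L : Submodule ℤ (EuclideanSpace ℝ (Fin m)))
    (hL : SeysenMeasure.IsLattice n L) :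
    ∃ B : Matrix (Fin n) (Fin m) ℝ, SeysenMeasure.IsLatticeBasis B L ∧
      SeysenMeasure.seysenMeasure B ≤
        Real.exp ((2 / Real.log 2 + 1) * Real.log n ^ 2 + 4 * Real.log n) := by
  obtain ⟨B, hB, rfl⟩ := hL
  have hBP := SeysenMeasure.mul_transpose_dualBasis hB
  obtain ⟨V, V', hV, hle⟩ :=
    SeysenMeasure.exists_unimodular_seysen_le hn (SeysenMeasure.posDef_gram hBP)
  have hVr := SeysenMeasure.map_intCast_mul_eq_one hV
  have hVr' := mul_eq_one_comm.1 hVr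
  have hind : LinearIndependent ℝ (SeysenMeasure.rowVec (V.map (Int.cast : ℤ → ℝ) * B)) := by
    refine SeysenMeasure.linearIndependent_rowVec_of_mul_eq_one
      (P := (SeysenMeasure.dualBasis B)ᵀ * V'.map (Int.cast : ℤ → ℝ)) ?_
    rw [Matrix.mul_assoc, ← Matrix.mul_assoc B, hBP, Matrix.one_mul, hVr]
  refine ⟨V.map (Int.cast : ℤ → ℝ) * B, ⟨hind, le_antisymm ?_ ?_⟩, ?_⟩
  · have h := SeysenMeasure.span_rowVec_mul_le V' (V.map (Int.cast : ℤ → ℝ) * B)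
    rwa [← Matrix.mul_assoc, hVr', Matrix.one_mul] at h
  · exact SeysenMeasure.span_rowVec_mul_le V B
  · rw [SeysenMeasure.seysenMeasure_eq hind]
    simpa only [Matrix.transpose_mul, Matrix.mul_assoc] using hle
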